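/- Let $S=\mathrm{diag}(1,i)$, $Z=\mathrm{diag}(1,-1)$, let $H$ be the Hadamard gate, and put $\widetilde S := HSH$. A single-qubit gate is *local Clifford* if it is a product of $H$'s and $S$'s. A *GS-LC form* $D$ with $m$ inputs and $n$ outputs consists of a simple graph $G$ with vertex set $I\sqcup O$, $|I|=m$, $|O|=n$, and a local Clifford gate $A_i$ for each input $i\in I$ and $B_o$ for each output $o\in O$. It represents, up to a nonzero scalar, the linear map $$\llbracket D\rrbracket=\Big(\bigotimes_{o\in O} B_o\Big)\Big(\sum_{x\in\{0,1\}^I,\;y\in\{0,1\}^O}(-1)^{\sum_{uv\in E(G)}z_uz_v}\,|y\rangle\langle x|\Big)\Big(\bigotimes_{i\in I} A_i\Big),\qquad z=(x,y).$$ The *local complementation rule* at a vertex $u$ replaces $G$ by its local complement $G\star u$ (adjacency of each pair of distinct neighbours of $u$ is toggled), introduces a gate $\widetilde S^\dagger$ at $u$ and a gate $S$ at every neighbour of $u$. Here introducing a gate $g$ at a vertex means replacing $B_o$ by $B_o\,g$ for an output $o$, and $A_i$ by $g\,A_i$ for an input $i$. **Theorem.** (1) Starting from any GS-LC form $D$,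 the local complementation rule can be applied finitely many times, at suitable vertices, so that in the resulting GS-LC form $D'$, up to nonzero scalars, every input gate lies in $\{S^k \mid k\ge 0\}\cup\{H, ZH\}$ and every output gate lies in $\{S^k\mid k\ge 0\}\cup\{H, HZ\}$ (these are matrix products: the right factor acts first). Moreover, for every sequence of applications of the rule, the map represented by the result is a nonzero scalar multiple of $\llbracket D\rrbracket$. (2) If $m=n$ and $\llbracket D\rrbracket$ is invertible (as it is when $D$ represents a Clifford circuit), then for every GS-LC form $D'$ obtained from $D$ by such applications and having its gates in the sets of (1), the map $\llbracket D'\rrbracket$ is, up to a nonzero scalar, an $n$-qubit circuit made of eight successive layers $$\mathrm{H}+\mathrm{S}+\mathrm{CZ}+\mathrm{CNOT}+\mathrm{H}+\mathrm{CZ}+\mathrm{S}+\mathrm{H}$$ (first layer applied first), where an H layer has an $H$ gate on each qubit of some subset of the qubits, an S layer has a power of $S$ on each qubit, a CZ layer is a product of CZ gates on distinct pairs of qubits, and the CNOT layer is any composition of CNOT gates. By (1), $\llbracket D\rrbracket$ itself is therefore such a circuit up to a nonzero scalar. -/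

import Mathlib

noncomputable section

namespace ZXClifford

/-! ### Single-qubit gates -/

/-- Linear maps on one qubit, as matrices in the computational basis. -/
abbrev QMat := Matrix (Fin 2) (Fin 2) ℂ

/-- The Hadamard gate. -/
def hadamard : QMat := ((1 / Real.sqrt 2 : ℝ) : ℂ) • !![1, 1; 1, -1]

/-- The phase gate `S = Z_{π/2}`. -/
def phaseS : QMat := !![1, 0; 0, Complex.I]

/-- The Pauli gate `Z`. -/
def pauliZ : QMat := !![1, 0; 0, -1]

/-- The local Clifford gates: all compositions of `H` and `S` gates. -/
def localClifford : Submonoid QMat := Submonoid.closure {hadamard, phaseS}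

theorem hadamard_mem : hadamard ∈ localClifford :=
  Submonoid.subset_closure (Set.mem_insert _ _)

theorem phaseS_mem : phaseS ∈ localClifford :=
  Submonoid.subset_closure (Set.mem_insert_of_mem _ rfl)

theorem phaseS_conjTranspose : phaseS.conjTranspose = phaseS ^ 3 := by
  ext i j
  fin_cases i <;> fin_cases j <;>
    simp [phaseS, pow_succ, Matrix.mul_apply, Fin.sum_univ_two, Matrix.conjTranspose_apply]

/-- The gate `H S† H`, the adjoint of `H S H`; it is the X-phase gate `X_{-π/2}`. -/
def sTildeDagger : QMat := hadamard * phaseS.conjTranspose * hadamard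

theorem sTildeDagger_mem : sTildeDagger ∈ localClifford := by
  unfold sTildeDagger
  rw [phaseS_conjTranspose]
  exact mul_mem (mul_mem hadamard_mem (pow_mem phaseS_mem 3)) hadamard_mem

/-- `A` and `B` are equal up to a nonzero scalar factor. -/
def Proportional {ι κ : Type*} (A B : Matrix ι κ ℂ) : Prop :=
  ∃ c : ℂ, c ≠ 0 ∧ A = c • B

/-! ### Maps on several qubits -/

/-- The tensor product of single-qubit maps, one for each qubit `j : ι`. The computational basis
of the qubits `ι` is indexed by `ι → Fin 2`. -/
def tensor {ι : Type*} [Fintype ι] (U : ι → QMat) : Matrix (ι → Fin 2) (ι → Fin 2) ℂ :=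
  Matrix.of fun y x => ∏ j, U j (y j) (x j)

open Classical in
/-- The sign `∏_{uv ∈ E(G)} (-1)^{x_u x_v}`. -/
def graphSign {V : Type*} [Fintype V] (G : SimpleGraph V) (x : V → Fin 2) : ℂ :=
  ∏ e : Sym2 V, if e ∈ G.edgeSet ∧ ∀ v ∈ e, x v = 1 then -1 else 1

/-- The local complementation `G ⋆ u`: the adjacency of any two distinct neighbours of `u` is
toggled, and all other adjacencies are unchanged. -/
def localComplement {V : Type*} (G : SimpleGraph V) (u : V) : SimpleGraph V where
  Adj v w := v ≠ w ∧ Xor (G.Adj v w) (G.Adj u v ∧ G.Adj u w)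
  symm := ⟨fun v w h => ⟨h.1.symm, by
    rw [G.adj_comm w v, and_comm (a := G.Adj u w)]; exact h.2⟩⟩
  loopless := ⟨fun _ h => h.1 rfl⟩

/-! ### GS-LC forms -/

/-- A GS-LC form with inputs `I` and outputs `O`: a graph whose vertices are phaseless Z-spiders,
each connected to exactly one input or output, whose edges are Hadamard edges, and a local Clifford
gate on each input and output wire. -/
structure GSLC (I O : Type*) where
  /-- the underlying graph -/
  graph : SimpleGraph (I ⊕ O)
  /-- the local Cliffords on the inputs -/
  inOp : I → QMat
  /-- the local Cliffords on the outputs -/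
  outOp : O → QMat
  inOp_mem : ∀ i, inOp i ∈ localClifford
  outOp_mem : ∀ o, outOp o ∈ localClifford

namespace GSLC

variable {I O : Type*}

/-- The linear map of a GS-LC form, up to normalisation: first the gates on the inputs, then the
graph, then the gates on the outputs. -/
def toMatrix [Fintype I] [Fintype O] [DecidableEq I] [DecidableEq O] (D : GSLC I O) :
    Matrix (O → Fin 2) (I → Fin 2) ℂ :=
  tensor D.outOp * (Matrix.of fun y x => graphSign D.graph (Sum.elim x y)) * tensor D.inOp

open Classical in
/-- One application of the local complementation rule at the vertex `u`: the graph is locally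
complemented at `u`, a gate `(HSH)†` is introduced at `u` and a gate `S` at each neighbour of `u`.
The new gates sit between the vertex and the gate already present on its wire: they are
multiplied on the right of output gates and on the left of input gates. -/
def localComp (D : GSLC I O) (u : I ⊕ O) : GSLC I O where
  graph := localComplement D.graph u
  inOp i :=
    (if Sum.inl i = u then sTildeDagger else if D.graph.Adj u (Sum.inl i) then phaseS else 1)
      * D.inOp i
  outOp o :=
    D.outOp o *
      (if Sum.inr o = u then sTildeDagger else if D.graph.Adj u (Sum.inr o) then phaseS else 1)
  inOp_mem i := by
    refine mul_mem ?_ (D.inOp_mem i)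
    split_ifs
    exacts [sTildeDagger_mem, phaseS_mem, one_mem _]
  outOp_mem o := by
    refine mul_mem (D.outOp_mem o) ?_
    split_ifs
    exacts [sTildeDagger_mem, phaseS_mem, one_mem _]

/-- Successive applications of the local complementation rule at the vertices in the list. -/
def localComps (D : GSLC I O) (us : List (I ⊕ O)) : GSLC I O := us.foldl localComp D

/-- Up to nonzero scalars, all gates on the inputs lie in `{Sⁿ, H, ZH}` and all gates on the
outputs lie in `{Sⁿ, H, HZ}` (matrix products: the rightmost factor acts first). -/
def IsReduced (D : GSLC I O) : Prop :=
  (∀ i, (∃ k : ℕ, Proportional (D.inOp i) (phaseS ^ k)) ∨ Proportional (D.inOp i) hadamard ∨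
    Proportional (D.inOp i) (pauliZ * hadamard)) ∧
  (∀ o, (∃ k : ℕ, Proportional (D.outOp o) (phaseS ^ k)) ∨ Proportional (D.outOp o) hadamard ∨
    Proportional (D.outOp o) (hadamard * pauliZ))

end GSLC

/-! ### The layers of the normal form -/

/-- Linear maps on `n` qubits, as matrices in the computational basis. -/
abbrev NMat (n : ℕ) := Matrix (Fin n → Fin 2) (Fin n → Fin 2) ℂ

/-- A layer of Hadamard gates on the qubits in `T`. -/
def hLayer {n : ℕ} (T : Finset (Fin n)) : NMat n :=
  tensor fun j => if j ∈ T then hadamard else 1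

/-- A layer of powers of `S` gates. -/
def sLayer {n : ℕ} (k : Fin n → ℕ) : NMat n := tensor fun j => phaseS ^ k j

/-- A layer of CZ gates, one on each edge of `G`. -/
def czLayer {n : ℕ} (G : SimpleGraph (Fin n)) : NMat n := Matrix.diagonal (graphSign G)

/-- The CNOT gate with control `c` and target `t`: it maps the basis state `x` to the basis state
with `x_t` replaced by `x_t ⊕ x_c`. -/
def cnot {n : ℕ} (c t : Fin n) : NMat n :=
  Matrix.of fun y x => if y = Function.update x t (x t + x c) then 1 else 0

/-- The CNOT circuits: all compositions of CNOT gates. -/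
def cnotCircuits (n : ℕ) : Submonoid (NMat n) :=
  Submonoid.closure {M | ∃ c t : Fin n, c ≠ t ∧ M = cnot c t}

/-- `M` is, up to a nonzero scalar, a circuit with the eight layers
`H + S + CZ + CNOT + H + CZ + S + H` in the order of time (so read from right to left in the
matrix product). -/
def HasEightLayerForm {n : ℕ} (M : NMat n) : Prop :=
  ∃ (T₁ T₂ T₃ : Finset (Fin n)) (k₁ k₂ : Fin n → ℕ) (G₁ G₂ : SimpleGraph (Fin n)),
    ∃ P ∈ cnotCircuits n,
      Proportional M
        (hLayer T₃ * sLayer k₂ * czLayer G₂ * hLayer T₂ * P * czLayer G₁ * sLayer k₁ * hLayer T₁)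

end ZXClifford

end

/-! Bending the input wires turns the map into a graph state with one gate per vertex, input gates
being transposed. The rule preserves this vector exactly: with `a` neighbours of `u` in state 1, the
new `S` gates give `i^a` and the toggled edges give `(-1)^(a choose 2)`. Together these are
`i^(a^2)`, which depends only on the parity of `a` and cancels the eigenvalue of `H S† H` on `|0⟩ +
(-1)^a |1⟩` (`tensor_localCompGate_mulVec_graphSign`).

For reduction, scalars are dropped and gates become 24 words on which the rule acts combinatorially.
A gate is diagonal, X or Y according to the Pauli into which conjugation by its inverse carries `Z`.
Right multiplication by `S` fixes the diagonal class and exchanges X and Y; right multiplication by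
`H S† H` exchanges the diagonal and Y classes. Complementing at a Y vertex thus lowers the number of
non-diagonal vertices, and odd powers of `S` to the left of an `H` are removed by a second, inner
descent (`exists_reaches_isPreReduced`). Only Pauli corrections remain; complementing twice at a
vertex puts `X` there and `Z` on its neighbours, and removes them.

For the circuit, edges among inputs and among outputs are CZ layers, while the bipartite edges give
signs `(-1)^(y · Γx)`, which are the entries of a full Hadamard layer after `x ↦ Γx`
(`proportional_graphSign`). Invertibility of the map forces `Γ` to be invertible over `ℤ/2`, and
Gaussian elimination writes it in CNOTs. -/

namespace ZXClifford

open Matrix Finset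

/-! ### Proportional matrices -/

namespace Proportional

variable {ι κ μ : Type*} {A B C : Matrix ι κ ℂ}

theorem refl (A : Matrix ι κ ℂ) : Proportional A A := ⟨1, one_ne_zero, (one_smul _ _).symm⟩

theorem of_eq (h : A = B) : Proportional A B := h ▸ refl A

theorem symm : Proportional A B → Proportional B A := by
  rintro ⟨c, hc, rfl⟩
  exact ⟨c⁻¹, inv_ne_zero hc, by rw [smul_smul, inv_mul_cancel₀ hc, one_smul]⟩

theorem trans : Proportional A B → Proportional B C → Proportional A C := by
  rintro ⟨c, hc, rfl⟩ ⟨d, hd, rfl⟩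
  exact ⟨c * d, mul_ne_zero hc hd, smul_smul _ _ _⟩

theorem mul [Fintype κ] {A' B' : Matrix κ μ ℂ} :
    Proportional A B → Proportional A' B' → Proportional (A * A') (B * B') := by
  rintro ⟨c, hc, rfl⟩ ⟨d, hd, rfl⟩
  exact ⟨c * d, mul_ne_zero hc hd, by rw [Matrix.smul_mul, Matrix.mul_smul, smul_smul]⟩

theorem transpose : Proportional A B → Proportional Aᵀ Bᵀ := by
  rintro ⟨c, hc, rfl⟩
  exact ⟨c, hc, transpose_smul c B⟩

end Proportional

/-! ### Tensor products of single-qubit maps -/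

section Tensor

variable {ι : Type*} [Fintype ι]

theorem tensor_apply (U : ι → QMat) (y x : ι → Fin 2) : tensor U y x = ∏ j, U j (y j) (x j) := rfl

theorem tensor_mul [DecidableEq ι] (U W : ι → QMat) :
    tensor U * tensor W = tensor fun j => U j * W j := by
  ext y x
  simp only [mul_apply, tensor_apply, prod_univ_sum, Fintype.piFinset_univ, prod_mul_distrib]

theorem Proportional.tensor {U W : ι → QMat} (h : ∀ j, Proportional (U j) (W j)) :
    Proportional (tensor U) (tensor W) := by
  choose c hc h using h
  refine ⟨∏ j, c j, prod_ne_zero_iff.2 fun j _ => hc j, ?_⟩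
  ext y x
  simp [tensor_apply, h, prod_mul_distrib]

/-- A tensor product whose factors away from `u` are diagonal acts on the qubit `u` alone, up to
the diagonal entries of the other factors. -/
theorem tensor_mulVec_of_diagonal [DecidableEq ι] (u : ι) (g : ι → QMat)
    (hg : ∀ v ≠ u, ∀ a b, a ≠ b → g v a b = 0) (f : (ι → Fin 2) → ℂ) (z : ι → Fin 2) :
    (tensor g *ᵥ f) z = (∏ v ∈ univ.erase u, g v (z v) (z v)) *
      ∑ b, g u (z u) b * f (Function.update z u b) := by
  have h (b : Fin 2) : ∑ w : ι → Fin 2 with w u = b, tensor g z w * f w =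
      (∏ v ∈ univ.erase u, g v (z v) (z v)) * (g u (z u) b * f (Function.update z u b)) := by
    rw [sum_eq_single (Function.update z u b)]
    · rw [tensor_apply, ← mul_prod_erase univ _ (mem_univ u), Function.update_self]
      rw [prod_congr rfl fun v hv => by rw [Function.update_of_ne (ne_of_mem_erase hv)]]
      ring
    · intro w hw hne
      obtain ⟨v, hv⟩ := Function.ne_iff.1 hne
      have hvu : v ≠ u := by
        rintro rfl
        simp_all
      rw [Function.update_of_ne hvu] at hv
      rw [tensor_apply, prod_eq_zero (mem_univ v) (hg v hvu _ _ hv.symm), zero_mul]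
    · simp
  rw [mulVec, dotProduct, ← sum_fiberwise univ fun w : ι → Fin 2 => w u, mul_sum]
  exact sum_congr rfl fun b _ => h b

end Tensor

/-! ### Gates -/

theorem inv_sqrt_two_mul_self :
    ((1 / Real.sqrt 2 : ℝ) : ℂ) * ((1 / Real.sqrt 2 : ℝ) : ℂ) = 1 / 2 := by
  rw [← Complex.ofReal_mul, div_mul_div_comm, Real.mul_self_sqrt (by norm_num)]
  norm_num

theorem inv_sqrt_two_ne_zero : ((1 / Real.sqrt 2 : ℝ) : ℂ) ≠ 0 := by
  intro h
  have := inv_sqrt_two_mul_self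
  rw [h] at this
  norm_num at this

theorem hadamard_mul_mul_hadamard (M : QMat) : hadamard * M * hadamard =
    (1 / 2 : ℂ) • (!![1, 1; 1, -1] * M * !![1, 1; 1, -1]) := by
  rw [hadamard, Matrix.smul_mul, Matrix.smul_mul, Matrix.mul_smul, smul_smul, inv_sqrt_two_mul_self]

theorem hadamard_transpose : hadamardᵀ = hadamard := by
  rw [hadamard, transpose_smul]
  congr 1
  ext i j
  fin_cases i <;> fin_cases j <;> rfl

theorem phaseS_transpose : phaseSᵀ = phaseS := by
  ext i j
  fin_cases i <;> fin_cases j <;> rfl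

theorem pauliZ_transpose : pauliZᵀ = pauliZ := by
  ext i j
  fin_cases i <;> fin_cases j <;> rfl

theorem sTildeDagger_transpose : sTildeDaggerᵀ = sTildeDagger := by
  rw [sTildeDagger, phaseS_conjTranspose, transpose_mul, transpose_mul, transpose_pow,
    hadamard_transpose, phaseS_transpose, Matrix.mul_assoc]

theorem phaseS_pow (k : ℕ) : phaseS ^ k = !![1, 0; 0, Complex.I ^ k] := by
  induction k with
  | zero => simp [one_fin_two]
  | succ k ih => rw [pow_succ, ih, phaseS]; simp [pow_succ]

theorem sTildeDagger_eq : sTildeDagger =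
    (1 / 2 : ℂ) • !![1 - Complex.I, 1 + Complex.I; 1 + Complex.I, 1 - Complex.I] := by
  rw [sTildeDagger, hadamard_mul_mul_hadamard, phaseS_conjTranspose, phaseS_pow]
  congr 1
  ext i j
  fin_cases i <;> fin_cases j <;> simp [Complex.I_pow_three, sub_eq_add_neg]

/-! ### Local complementation and graph states -/

section Graph

variable {V : Type*} [Fintype V] (G : SimpleGraph V) (u : V) (z : V → Fin 2)

theorem prod_ite_neg_one {ι : Type*} [Fintype ι] (p : ι → Prop) [DecidablePred p] :
    ∏ e, (if p e then (-1 : ℂ) else 1) = (-1) ^ #{e | p e} := by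
  rw [prod_ite, prod_const, prod_const_one, mul_one]

open Classical in
/-- The neighbours of `u` with value `1`. -/
noncomputable def activeNeighbors : Finset V := {v | G.Adj u v ∧ z v = 1}

theorem mem_activeNeighbors {v : V} : v ∈ activeNeighbors G u z ↔ G.Adj u v ∧ z v = 1 := by
  simp [activeNeighbors]

theorem activeNeighbors_update [DecidableEq V] (b : Fin 2) :
    activeNeighbors G u (Function.update z u b) = activeNeighbors G u z := by
  ext v
  simp only [mem_activeNeighbors]
  refine and_congr_right fun h => ?_
  rw [Function.update_of_ne h.ne']

/-- Toggling a pair changes the sign exactly when both ends have value 1, so the ratio of the two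
signs is that of the complete graph on the active neighbours. -/
theorem graphSign_localComplement : graphSign (localComplement G u) z =
    graphSign G z * (-1) ^ (#(activeNeighbors G u z)).choose 2 := by
  classical
  set A := activeNeighbors G u z with hA
  have key : ∏ e : Sym2 V, (if ¬ e.IsDiag ∧ ∀ v ∈ e, v ∈ A then (-1 : ℂ) else 1) =
      (-1) ^ (#A).choose 2 := by
    rw [prod_ite_neg_one, ← Sym2.card_image_offDiag]
    congr 2
    ext e
    induction e with
    | _ v w =>
      simp only [mem_filter, mem_univ, true_and, Sym2.mk_isDiag_iff, Sym2.mem_iff,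
        forall_eq_or_imp, forall_eq, mem_image, mem_offDiag, Prod.exists]
      constructor
      · rintro ⟨h, hv, hw⟩
        exact ⟨v, w, ⟨hv, hw, h⟩, rfl⟩
      · rintro ⟨a, b, ⟨ha, hb, h⟩, hab⟩
        rcases Sym2.eq_iff.1 hab with ⟨rfl, rfl⟩ | ⟨rfl, rfl⟩
        exacts [⟨h, ha, hb⟩, ⟨Ne.symm h, hb, ha⟩]
  rw [← key, graphSign, graphSign, ← prod_mul_distrib]
  refine prod_congr rfl fun e _ => ?_
  induction e with
  | _ v w =>
    have hvw : G.Adj v w → v ≠ w := fun h => h.ne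
    simp only [SimpleGraph.mem_edgeSet, Sym2.mk_isDiag_iff, Sym2.mem_iff, forall_eq_or_imp,
      forall_eq, hA, mem_activeNeighbors, localComplement, Xor]
    by_cases h1 : v = w <;> by_cases h2 : G.Adj v w <;> by_cases h3 : G.Adj u v <;>
      by_cases h4 : G.Adj u w <;> by_cases h5 : z v = 1 <;> by_cases h6 : z w = 1 <;>
      simp_all

/-- Raising `u` from 0 to 1 switches on exactly the edges from `u` to its active neighbours. -/
theorem graphSign_update_one [DecidableEq V] (hz : z u = 0) :
    graphSign G (Function.update z u 1) = graphSign G z * (-1) ^ #(activeNeighbors G u z) := by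
  classical
  set A := activeNeighbors G u z with hA
  have key : ∏ e : Sym2 V, (if ∃ v ∈ A, s(u, v) = e then (-1 : ℂ) else 1) = (-1) ^ #A := by
    rw [prod_ite_neg_one, ← card_image_of_injective A
      (f := fun v => s(u, v)) fun v w h => Sym2.congr_right.1 h]
    congr 2
    ext e
    simp
  rw [← key, graphSign, graphSign, ← prod_mul_distrib]
  refine prod_congr rfl fun e _ => ?_
  by_cases hu : u ∈ e
  · obtain ⟨w, rfl⟩ := hu
    have h1 : (∃ v ∈ A, s(u, v) = s(u, w)) ↔ G.Adj u w ∧ z w = 1 := by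
      simp only [Sym2.congr_right, exists_eq_right, hA, mem_activeNeighbors]
    simp only [h1]
    by_cases h : G.Adj u w
    · simp [h, hz, Function.update_of_ne h.ne']
    · simp [h]
  · have h1 : ¬ ∃ v ∈ A, s(u, v) = e := by
      rintro ⟨v, -, rfl⟩
      exact hu (Sym2.mem_mk_left _ _)
    have h2 : (∀ v ∈ e, Function.update z u 1 v = 1) ↔ ∀ v ∈ e, z v = 1 := by
      refine forall₂_congr fun v hv => ?_
      rw [Function.update_of_ne]
      rintro rfl
      exact hu hv
    simp only [h1, h2, if_false, mul_one]
    congr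

/-- The exponent of `i` is `k + k(k-1) = k^2`, which is 0 or 1 modulo 4. -/
theorem I_pow_mul_neg_one_pow_choose (k : ℕ) :
    Complex.I ^ k * (-1) ^ k.choose 2 = if Even k then 1 else Complex.I := by
  induction k with
  | zero => simp
  | succ k ih =>
    rw [Nat.choose_succ_succ' k 1, Nat.choose_one_right, pow_succ, pow_add]
    have : Complex.I ^ k * Complex.I * ((-1) ^ k * (-1) ^ k.choose 2) =
        Complex.I ^ k * (-1) ^ k.choose 2 * (Complex.I * (-1) ^ k) := by ring
    rw [this, ih]
    rcases Nat.even_or_odd k with h | h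
    · simp [h, h.neg_one_pow, Nat.even_add_one]
    · simp [h.neg_one_pow, Nat.even_add_one, Nat.not_even_iff_odd.2 h]

open Classical in
/-- The gates introduced by the local complementation rule at `u`. -/
noncomputable def localCompGate (v : V) : QMat :=
  if v = u then sTildeDagger else if G.Adj u v then phaseS else 1

omit [Fintype V] in
theorem localCompGate_transpose (v : V) : (localCompGate G u v)ᵀ = localCompGate G u v := by
  unfold localCompGate
  split_ifs
  exacts [sTildeDagger_transpose, phaseS_transpose, transpose_one]

/-- All gates off `u` are diagonal, so only the amplitudes at `z u = 0` and `z u = 1` mix. Their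
ratio is `(-1)^#A`; the vector `(1, ±1)` is an eigenvector of `H S† H` with eigenvalue `1` or `-i`,
and the phase `i^(#A ^ 2)` is `1` or `i` correspondingly. -/
theorem tensor_localCompGate_mulVec_graphSign [DecidableEq V] :
    tensor (localCompGate G u) *ᵥ graphSign (localComplement G u) = graphSign G := by
  classical
  ext z
  rw [tensor_mulVec_of_diagonal u]
  · set A := activeNeighbors G u z with hA
    have hprod : ∏ v ∈ univ.erase u, localCompGate G u v (z v) (z v) = Complex.I ^ #A := by
      have : ∀ v ∈ univ.erase u, localCompGate G u v (z v) (z v) =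
          if v ∈ A then Complex.I else 1 := by
        intro v hv
        simp only [hA, mem_activeNeighbors]
        rw [localCompGate, if_neg (ne_of_mem_erase hv)]
        by_cases h : G.Adj u v
        · generalize z v = a
          fin_cases a <;> simp [h, phaseS]
        · simp [h]
      rw [prod_congr rfl this, prod_ite, prod_const, prod_const_one, mul_one]
      congr 2
      ext v
      simp only [mem_filter, mem_erase, mem_univ, and_true, and_iff_right_iff_imp]
      rintro h rfl
      exact G.irrefl ((mem_activeNeighbors ..).1 h).1
    have h0 : graphSign G (Function.update z u 1) =
        graphSign G (Function.update z u 0) * (-1) ^ #A := by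
      have := graphSign_update_one G u (Function.update z u 0) (by simp)
      rwa [Function.update_idem, activeNeighbors_update] at this
    have hz : graphSign G z = graphSign G (Function.update z u 0) *
        if z u = 0 then 1 else (-1) ^ #A := by
      split_ifs with h
      · rw [← h, Function.update_eq_self, mul_one]
      · have h1 : z u = 1 := by omega
        rw [← h0, ← h1, Function.update_eq_self]
    rw [hprod, Fin.sum_univ_two, graphSign_localComplement, graphSign_localComplement,
      activeNeighbors_update, activeNeighbors_update, ← hA, h0, hz, localCompGate, if_pos rfl,
      sTildeDagger_eq]
    have key := I_pow_mul_neg_one_pow_choose #A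
    set s := graphSign G (Function.update z u 0)
    generalize z u = a
    have hI := Complex.I_mul_I
    calc _ = Complex.I ^ #A * (-1) ^ (#A).choose 2 * s *
          (((1 / 2 : ℂ) • !![1 - Complex.I, 1 + Complex.I; 1 + Complex.I, 1 - Complex.I]) a 0 +
          ((1 / 2 : ℂ) • !![1 - Complex.I, 1 + Complex.I; 1 + Complex.I, 1 - Complex.I]) a 1 *
            (-1) ^ #A) := by ring
      _ = _ := by
        rw [key]
        rcases Nat.even_or_odd #A with h | h
        · rw [h.neg_one_pow, if_pos h]
          fin_cases a <;> simp <;> ring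
        · rw [h.neg_one_pow, if_neg (Nat.not_even_iff_odd.2 h)]
          fin_cases a
          · simp
            linear_combination (-s) * hI
          · simp
            linear_combination s * hI
  · intro v hv a b hab
    rw [localCompGate, if_neg hv]
    split_ifs
    · fin_cases a <;> fin_cases b <;> simp_all [phaseS]
    · exact one_apply_ne hab

end Graph

/-! ### Invariance of the represented map -/

namespace GSLC

variable {I O : Type*}

/-- The gates of a GS-LC form, regarded as acting on the graph state. -/
def vertexOp (D : GSLC I O) : I ⊕ O → QMat := Sum.elim (fun i => (D.inOp i)ᵀ) D.outOp

/-- Transposition turns left multiplication on inputs into right multiplication, and the introduced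
gates are symmetric, so inputs and outputs obey one rule. -/
theorem vertexOp_localComp (D : GSLC I O) (u v : I ⊕ O) :
    (D.localComp u).vertexOp v = D.vertexOp v * localCompGate D.graph u v := by
  cases v with
  | inl i =>
    rw [← localCompGate_transpose]
    simp only [vertexOp, Sum.elim_inl, localComp, transpose_mul, localCompGate]
    congr 2
    split_ifs <;> rfl
  | inr o =>
    simp only [vertexOp, Sum.elim_inr, localComp, localCompGate]
    congr 1
    split_ifs <;> rfl

variable [Fintype I] [Fintype O] [DecidableEq I] [DecidableEq O]

theorem toMatrix_apply (D : GSLC I O) (y : O → Fin 2) (x : I → Fin 2) :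
    D.toMatrix y x = (tensor D.vertexOp *ᵥ graphSign D.graph) (Sum.elim x y) := by
  rw [toMatrix, mul_apply, mulVec, dotProduct,
    ← (Equiv.sumArrowEquivProdArrow I O (Fin 2)).symm.sum_comp, Fintype.sum_prod_type]
  refine sum_congr rfl fun x' _ => ?_
  rw [mul_apply, sum_mul]
  refine sum_congr rfl fun y' _ => ?_
  simp only [tensor_apply, of_apply, Fintype.prod_sum_type, vertexOp, Sum.elim_inl, Sum.elim_inr,
    transpose_apply, Equiv.sumArrowEquivProdArrow_symm_apply_inl,
    Equiv.sumArrowEquivProdArrow_symm_apply_inr]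
  rw [show (Equiv.sumArrowEquivProdArrow I O (Fin 2)).symm (x', y') = Sum.elim x' y' from rfl]
  ring

theorem toMatrix_localComp (D : GSLC I O) (u : I ⊕ O) : (D.localComp u).toMatrix = D.toMatrix := by
  ext y x
  rw [toMatrix_apply, toMatrix_apply]
  have : tensor (D.localComp u).vertexOp =
      tensor D.vertexOp * tensor (localCompGate D.graph u) := by
    rw [tensor_mul]
    exact congrArg tensor (funext (vertexOp_localComp D u))
  rw [this, ← mulVec_mulVec]
  exact congrFun (congrArg _ (tensor_localCompGate_mulVec_graphSign D.graph u)) _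

theorem toMatrix_localComps (D : GSLC I O) (us : List (I ⊕ O)) :
    (D.localComps us).toMatrix = D.toMatrix := by
  induction us generalizing D with
  | nil => rfl
  | cons u us ih => exact (ih (D.localComp u)).trans (toMatrix_localComp D u)

end GSLC

/-! ### Normal forms of local Clifford gates -/

/-- The Pauli gate `X`. -/
noncomputable def pauliX : QMat := !![0, 1; 1, 0]

theorem hadamard_mul_hadamard : hadamard * hadamard = 1 := by
  have := hadamard_mul_mul_hadamard 1
  rw [Matrix.mul_one, Matrix.mul_one] at this
  rw [this]
  ext i j
  fin_cases i <;> fin_cases j <;> norm_num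

theorem pauliZ_eq : pauliZ = phaseS ^ 2 := by
  rw [phaseS_pow, Complex.I_sq, pauliZ]

theorem phaseS_pow_four : phaseS ^ 4 = 1 := by
  rw [phaseS_pow, Complex.I_pow_four, one_fin_two]

theorem pauliX_mul_hadamard : pauliX * hadamard = hadamard * phaseS ^ 2 := by
  rw [phaseS_pow, hadamard, Matrix.mul_smul, Matrix.smul_mul, pauliX]
  simp

theorem hadamard_mul_phaseS_sq_mul_hadamard : hadamard * phaseS ^ 2 * hadamard = pauliX := by
  rw [← pauliX_mul_hadamard, Matrix.mul_assoc, hadamard_mul_hadamard, Matrix.mul_one]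

theorem pauliX_mul_phaseS : Proportional (pauliX * phaseS) (phaseS ^ 3 * pauliX) := by
  refine ⟨Complex.I, Complex.I_ne_zero, ?_⟩
  rw [phaseS_pow, phaseS, pauliX]
  simp [Complex.I_pow_three]

/-- An Euler decomposition: a quarter turn about X is, up to phase, `S† H S†`, with `S† = S^3`. It
is what lets the words absorb a further `H`. -/
theorem hadamard_phaseS_hadamard : Proportional (hadamard * phaseS * hadamard)
    (phaseS ^ 3 * hadamard * phaseS ^ 3) := by
  -- The middle Hadamard is left unnormalised so that no square root enters the entrywise check.
  have h : hadamard * phaseS * hadamard =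
      ((1 + Complex.I) / 2) • (phaseS ^ 3 * !![1, 1; 1, -1] * phaseS ^ 3) := by
    rw [hadamard_mul_mul_hadamard, phaseS_pow, phaseS]
    ext i j
    fin_cases i <;> fin_cases j <;> simp [Complex.I_pow_three] <;>
      first | ring1 | linear_combination (1 / 2 : ℂ) * Complex.I_mul_I
  rw [h, hadamard, Matrix.mul_smul, Matrix.smul_mul]
  refine (Proportional.trans ⟨_, ?_, rfl⟩ (Proportional.symm ⟨_, inv_sqrt_two_ne_zero, rfl⟩))
  intro h
  simpa using congrArg Complex.re h

theorem hadamard_phaseS_cube_hadamard : Proportional (hadamard * phaseS ^ 3 * hadamard)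
    (phaseS * hadamard * phaseS) := by
  have h : hadamard * phaseS ^ 3 * hadamard =
      ((1 - Complex.I) / 2) • (phaseS * !![1, 1; 1, -1] * phaseS) := by
    rw [hadamard_mul_mul_hadamard, phaseS_pow, phaseS]
    ext i j
    fin_cases i <;> fin_cases j <;> simp [Complex.I_pow_three] <;>
      first | ring1 | linear_combination (1 / 2 : ℂ) * Complex.I_mul_I
  rw [h, hadamard, Matrix.mul_smul, Matrix.smul_mul]
  refine (Proportional.trans ⟨_, ?_, rfl⟩ (Proportional.symm ⟨_, inv_sqrt_two_ne_zero, rfl⟩))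
  intro h
  simpa using congrArg Complex.re h

theorem phaseS_pow_val_add (a b : Fin 4) :
    phaseS ^ (a + b).val = phaseS ^ a.val * phaseS ^ b.val := by
  rw [← pow_add, Fin.val_add, ← Nat.div_add_mod (a.val + b.val) 4, pow_add, pow_mul,
    phaseS_pow_four, one_pow, Nat.div_add_mod, Matrix.one_mul]

/-- Names for the local Clifford gates up to scalars: `diag a false` is `S^a`, `diag a true` is
`S^a X` and `mixed a b` is `S^a H S^b`. -/
inductive CliffordWord
  | diag (a : Fin 4) (x : Bool)
  | mixed (a b : Fin 4)

namespace CliffordWord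

/-- The gate named by a word. -/
noncomputable def gate : CliffordWord → QMat
  | diag a false => phaseS ^ a.val
  | diag a true => phaseS ^ a.val * pauliX
  | mixed a b => phaseS ^ a.val * hadamard * phaseS ^ b.val

/-- Right multiplication by `S`. -/
def mulS : CliffordWord → CliffordWord
  | diag a false => diag (a + 1) false
  | diag a true => diag (a + 3) true
  | mixed a b => mixed a (b + 1)

/-- Right multiplication by `H`. -/
def mulH : CliffordWord → CliffordWord
  | diag a false => mixed a 0
  | diag a true => mixed a 2
  | mixed a 0 => diag a false
  | mixed a 1 => mixed (a + 3) 3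
  | mixed a 2 => diag a true
  | mixed a 3 => mixed (a + 1) 1

/-- Right multiplication by `H S† H`. -/
def mulT (w : CliffordWord) : CliffordWord := w.mulH.mulS.mulS.mulS.mulH

theorem gate_mulS (w : CliffordWord) : Proportional (w.gate * phaseS) w.mulS.gate := by
  match w with
  | diag a false =>
    refine .of_eq ?_
    rw [mulS, gate, gate, phaseS_pow_val_add]
    simp
  | diag a true =>
    rw [mulS, gate, gate, phaseS_pow_val_add, Matrix.mul_assoc, Matrix.mul_assoc]
    exact (Proportional.refl _).mul pauliX_mul_phaseS
  | mixed a b =>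
    refine .of_eq ?_
    rw [mulS, gate, gate, phaseS_pow_val_add, ← Matrix.mul_assoc]
    simp

theorem gate_mulH (w : CliffordWord) : Proportional (w.gate * hadamard) w.mulH.gate := by
  match w with
  | diag a false => exact .of_eq (by simp [mulH, gate])
  | diag a true =>
    refine .of_eq ?_
    rw [mulH, gate, gate, Matrix.mul_assoc, pauliX_mul_hadamard, ← Matrix.mul_assoc]
    rfl
  | mixed a 0 =>
    refine .of_eq ?_
    rw [mulH, gate, gate, Fin.val_zero, pow_zero, Matrix.mul_one, Matrix.mul_assoc,
      hadamard_mul_hadamard, Matrix.mul_one]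
  | mixed a 1 =>
    have := (Proportional.refl (phaseS ^ a.val)).mul hadamard_phaseS_hadamard
    rw [mulH, gate, gate, phaseS_pow_val_add]
    simpa [Matrix.mul_assoc] using this
  | mixed a 2 =>
    refine .of_eq ?_
    rw [mulH, gate, gate, ← hadamard_mul_phaseS_sq_mul_hadamard]
    simp only [Matrix.mul_assoc]
    rfl
  | mixed a 3 =>
    have := (Proportional.refl (phaseS ^ a.val)).mul hadamard_phaseS_cube_hadamard
    rw [mulH, gate, gate, phaseS_pow_val_add]
    simpa [Matrix.mul_assoc] using this

theorem gate_mulT (w : CliffordWord) : Proportional (w.gate * sTildeDagger) w.mulT.gate := by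
  have step {A : QMat} {w : CliffordWord} (h : Proportional A w.gate) :
      Proportional (A * phaseS) w.mulS.gate := (h.mul (.refl _)).trans (gate_mulS w)
  have h := ((step (step (step (gate_mulH w)))).mul (.refl hadamard)).trans (gate_mulH _)
  rw [sTildeDagger, phaseS_conjTranspose, mulT]
  simpa only [pow_succ, pow_zero, Matrix.one_mul, Matrix.mul_assoc] using h

/-- The words contain the identity and are closed, up to scalars, under right multiplication by both
generators. -/
theorem exists_gate {A : QMat} (hA : A ∈ localClifford) :
    ∃ w : CliffordWord, Proportional A w.gate := by
  induction hA using Submonoid.closure_induction_right with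
  | one => exact ⟨diag 0 false, .of_eq (by simp [gate])⟩
  | mul_right A _ B hB ih =>
    obtain ⟨w, hw⟩ := ih
    rcases hB with rfl | rfl
    · exact ⟨w.mulH, (hw.mul (.refl _)).trans (gate_mulH w)⟩
    · exact ⟨w.mulS, (hw.mul (.refl _)).trans (gate_mulS w)⟩

/-- The gate maps `Z` to `±Z` under conjugation. -/
def IsDiag : CliffordWord → Prop
  | diag _ _ => True
  | mixed _ _ => False

/-- Conjugation by the inverse of the gate maps `Z` to `±X`. -/
def IsX : CliffordWord → Prop
  | diag _ _ => False
  | mixed _ b => b = 0 ∨ b = 2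

/-- Conjugation by the inverse of the gate maps `Z` to `±Y`. -/
def IsY : CliffordWord → Prop
  | diag _ _ => False
  | mixed _ b => b = 1 ∨ b = 3

/-- The gate is of the form `S^a H S^b` with `b` even and `a` odd. -/
def IsOddX : CliffordWord → Prop
  | diag _ _ => False
  | mixed a b => (a = 1 ∨ a = 3) ∧ (b = 0 ∨ b = 2)

/-- The gate is a Pauli gate times a power of `S` or `H`. -/
def IsPreReduced : CliffordWord → Prop
  | diag _ _ => True
  | mixed a b => (a = 0 ∨ a = 2) ∧ (b = 0 ∨ b = 2)

/-- The gate is one of `S^k`, `H` and `H Z`. -/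
def IsReduced : CliffordWord → Prop
  | diag _ x => x = false
  | mixed a b => a = 0 ∧ (b = 0 ∨ b = 2)

variable (w : CliffordWord)

theorem isY_of_not (h : ¬ w.IsDiag) (h' : ¬ w.IsX) : w.IsY := by
  cases w with
  | diag => exact absurd trivial h
  | mixed a b => clear h; revert b; simp only [IsX, IsY]; decide

theorem isPreReduced_of_not (h : ¬ w.IsY) (h' : ¬ w.IsOddX) : w.IsPreReduced := by
  cases w with
  | diag => trivial
  | mixed a b => revert a b; simp only [IsY, IsOddX, IsPreReduced]; decide

theorem IsOddX.not_isDiag {w : CliffordWord} (h : w.IsOddX) : ¬ w.IsDiag := by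
  cases w with
  | diag => exact h.elim
  | mixed => exact id

theorem IsDiag.mulS {w : CliffordWord} (h : w.IsDiag) : w.mulS.IsDiag := by
  match w, h with
  | diag a false, _ => trivial
  | diag a true, _ => trivial

theorem IsDiag.not_isOddX {w : CliffordWord} (h : w.IsDiag) : ¬ w.IsOddX := by
  cases w with
  | diag => exact id
  | mixed => exact h.elim

/-- `S` is a quarter turn about the Z axis, exchanging `X` and `Y` up to sign. -/
theorem IsX.isY_mulS {w : CliffordWord} (h : w.IsX) : w.mulS.IsY := by
  cases w with
  | diag => exact h.elim
  | mixed a b => revert b; simp only [IsX, IsY, CliffordWord.mulS]; decide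

/-- `H S† H` is a quarter turn about the X axis, exchanging `Y` and `Z` up to sign. -/
theorem IsY.isDiag_mulT {w : CliffordWord} (h : w.IsY) : w.mulT.IsDiag := by
  cases w with
  | diag => exact h.elim
  | mixed a b =>
    rcases h with rfl | rfl <;> simp [CliffordWord.mulT, CliffordWord.mulS, mulH, IsDiag]

/-- For even `b`, the factor `H S† H` passes through `H S^b` as an odd power of `S`, changing the
parity of `a`. -/
theorem IsOddX.not_isOddX_mulT {w : CliffordWord} (h : w.IsOddX) : ¬ w.mulT.IsOddX := by
  cases w with
  | diag => exact h.elim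
  | mixed a b => rcases h with ⟨rfl | rfl, rfl | rfl⟩ <;>
      simp [CliffordWord.mulT, CliffordWord.mulS, mulH, IsOddX]

/-- `(H S† H)^2 = X`, which cancels the `X` in `S^a X` and, since `H X = Z H`, the `S^2` in `S^2 H
S^b`. -/
theorem IsPreReduced.isReduced_mulT_mulT {w : CliffordWord} (h : w.IsPreReduced)
    (h' : ¬ w.IsReduced) : w.mulT.mulT.IsReduced := by
  cases w with
  | diag a x =>
    cases x
    · exact absurd rfl h'
    · simp [CliffordWord.mulT, CliffordWord.mulS, mulH, IsReduced]
  | mixed a b =>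
    rcases h with ⟨rfl | rfl, rfl | rfl⟩ <;>
      simp_all [CliffordWord.mulT, CliffordWord.mulS, mulH, IsReduced]

theorem IsReduced.isPreReduced {w : CliffordWord} (h : w.IsReduced) : w.IsPreReduced := by
  cases w with
  | diag => trivial
  | mixed a b => exact ⟨.inl h.1, h.2⟩

theorem IsPreReduced.mulS_mulS {w : CliffordWord} (h : w.IsPreReduced) :
    w.mulS.mulS.IsPreReduced := by
  match w, h with
  | diag a false, _ => trivial
  | diag a true, _ => trivial
  | mixed a b, h =>
    rcases h with ⟨h, rfl | rfl⟩ <;> simp [CliffordWord.mulS, IsPreReduced, h]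

theorem IsReduced.mulS_mulS {w : CliffordWord} (h : w.IsReduced) : w.mulS.mulS.IsReduced := by
  match w, h with
  | diag a false, _ => rfl
  | mixed a b, h =>
    rcases h with ⟨h, rfl | rfl⟩ <;> simp [CliffordWord.mulS, IsReduced, h]

theorem IsReduced.gate {w : CliffordWord} (h : w.IsReduced) :
    (∃ k : ℕ, w.gate = phaseS ^ k) ∨ w.gate = hadamard ∨ w.gate = hadamard * pauliZ := by
  match w, h with
  | diag a false, _ => exact .inl ⟨a, rfl⟩
  | mixed a b, ⟨h, h'⟩ =>
    subst h
    rcases h' with rfl | rfl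
    · exact .inr (.inl (by simp [CliffordWord.gate]))
    · refine .inr (.inr ?_)
      simp [CliffordWord.gate, pauliZ_eq]

end CliffordWord

/-! ### Graphs labelled with local Clifford gates -/

/-- A graph with a local Clifford gate, up to scalars, on each vertex. -/
structure LabelledGraph (V : Type*) where
  /-- the underlying graph -/
  graph : SimpleGraph V
  /-- the gates on the vertices -/
  label : V → CliffordWord

namespace LabelledGraph

variable {V : Type*}

open Classical in
/-- The local complementation rule at `u`. -/
noncomputable def localComp (s : LabelledGraph V) (u : V) : LabelledGraph V where
  graph := localComplement s.graph u
  label v := if v = u then (s.label v).mulT else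
    if s.graph.Adj u v then (s.label v).mulS else s.label v

/-- The labelled graph `t` can be obtained from `s` by local complementations. -/
def Reaches (s t : LabelledGraph V) : Prop := ∃ us : List V, us.foldl localComp s = t

theorem Reaches.head {s t : LabelledGraph V} (u : V) (h : (s.localComp u).Reaches t) :
    s.Reaches t := by
  obtain ⟨us, h⟩ := h
  exact ⟨u :: us, h⟩

theorem Reaches.trans {s t r : LabelledGraph V} (h : s.Reaches t) (h' : t.Reaches r) :
    s.Reaches r := by
  obtain ⟨us, rfl⟩ := h
  obtain ⟨us', rfl⟩ := h'
  exact ⟨us ++ us', List.foldl_append⟩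

variable (s : LabelledGraph V) (u : V)

theorem label_localComp_self : (s.localComp u).label u = (s.label u).mulT := if_pos rfl

variable {s u} in
theorem label_localComp_of_ne {v : V} (h : v ≠ u) : (s.localComp u).label v = s.label v ∨
    s.graph.Adj u v ∧ (s.localComp u).label v = (s.label v).mulS := by
  by_cases h' : s.graph.Adj u v
  · exact .inr ⟨h', by simp [localComp, h, h']⟩
  · exact .inl (by simp [localComp, h, h'])

variable {s u} in
theorem label_localComp_of_adj {v : V} (h : s.graph.Adj u v) :
    (s.localComp u).label v = (s.label v).mulS := by
  simp [localComp, h, h.ne']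

variable {s u} in
-- Complementing at `u` leaves the neighbourhood of `u` unchanged, so `v` receives `S` both times or
-- not at all.
theorem label_localComp_localComp_of_ne {v : V} (h : v ≠ u) :
    ((s.localComp u).localComp u).label v = s.label v ∨
      ((s.localComp u).localComp u).label v = (s.label v).mulS.mulS := by
  by_cases h' : s.graph.Adj u v
  · refine .inr ?_
    rw [label_localComp_of_adj, label_localComp_of_adj h']
    simp [localComp, localComplement, h.symm, h', Xor]
  · refine .inl ?_
    simp [localComp, localComplement, h, h', Xor]

variable [Fintype V]

open Classical in
/-- The vertices whose label is not diagonal. -/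
noncomputable def nonDiag : Finset V := {v | ¬ (s.label v).IsDiag}

open Classical in
/-- The vertices whose label is `S^a H S^b` with `a` odd and `b` even. -/
noncomputable def oddX : Finset V := {v | (s.label v).IsOddX}

open Classical in
/-- The vertices whose label is not reduced. -/
noncomputable def nonReduced : Finset V := {v | ¬ (s.label v).IsReduced}

theorem mem_nonDiag {v : V} : v ∈ s.nonDiag ↔ ¬ (s.label v).IsDiag := by simp [nonDiag]

theorem mem_oddX {v : V} : v ∈ s.oddX ↔ (s.label v).IsOddX := by simp [oddX]

theorem mem_nonReduced {v : V} : v ∈ s.nonReduced ↔ ¬ (s.label v).IsReduced := by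
  simp [nonReduced]

variable {s u}

theorem nonDiag_localComp_subset (hu : ¬ (s.label u).IsDiag) :
    (s.localComp u).nonDiag ⊆ s.nonDiag := by
  intro v hv
  rw [mem_nonDiag] at hv ⊢
  by_cases h : v = u
  · exact h ▸ hu
  · rcases label_localComp_of_ne h with h' | ⟨-, h'⟩
    · rwa [h'] at hv
    · rw [h'] at hv
      exact fun h => hv h.mulS

theorem card_nonDiag_localComp_lt (hu : (s.label u).IsY) :
    #(s.localComp u).nonDiag < #s.nonDiag := by
  have hu' : ¬ (s.label u).IsDiag := by
    intro h
    revert h hu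
    cases s.label u with
    | diag => exact fun h _ => h.elim
    | mixed => exact fun _ h => h.elim
  refine card_lt_card ((ssubset_iff_of_subset (nonDiag_localComp_subset hu')).2 ⟨u, ?_, ?_⟩)
  · rwa [mem_nonDiag]
  · rw [mem_nonDiag, label_localComp_self, not_not]
    exact hu.isDiag_mulT

theorem card_oddX_localComp_lt (hu : (s.label u).IsOddX)
    (h : ∀ v, s.graph.Adj u v → (s.label v).IsDiag) :
    #(s.localComp u).oddX < #s.oddX := by
  refine card_lt_card ((ssubset_iff_of_subset ?_).2 ⟨u, ?_, ?_⟩)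
  · intro v hv
    rw [mem_oddX] at hv ⊢
    by_cases hvu : v = u
    · exact hvu ▸ hu
    · rcases label_localComp_of_ne hvu with h' | ⟨ha, h'⟩
      · rwa [h'] at hv
      · rw [h'] at hv
        exact absurd hv (h v ha).mulS.not_isOddX
  · rwa [mem_oddX]
  · rw [mem_oddX, label_localComp_self]
    exact hu.not_isOddX_mulT

/-- Lexicographic descent on the number of non-diagonal vertices, then the number of odd X vertices.
A Y vertex lowers the first count. In the absence of Y vertices, an odd X vertex `u` either has an X
neighbour, which becomes Y after complementing at `u`, or has only diagonal neighbours, and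
complementing at `u` lowers the second count. -/
theorem exists_reaches_isPreReduced (s : LabelledGraph V) :
    ∃ t, s.Reaches t ∧ ∀ v, (t.label v).IsPreReduced := by
  induction hN : #s.nonDiag using Nat.strong_induction_on generalizing s with
  | _ N ihN =>
  induction hM : #s.oddX using Nat.strong_induction_on generalizing s with
  | _ M ihM =>
  subst hN hM
  by_cases hY : ∃ u, (s.label u).IsY
  · obtain ⟨u, hu⟩ := hY
    obtain ⟨t, ht, h⟩ := ihN _ (card_nonDiag_localComp_lt hu) _ rfl
    exact ⟨t, ht.head, h⟩
  push Not at hY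
  by_cases hX : ∃ u, (s.label u).IsOddX
  · obtain ⟨u, hu⟩ := hX
    have hsub := card_le_card (nonDiag_localComp_subset hu.not_isDiag)
    by_cases hv : ∃ v, s.graph.Adj u v ∧ (s.label v).IsX
    · obtain ⟨v, hadj, hv⟩ := hv
      have hlt : #((s.localComp u).localComp v).nonDiag < #(s.localComp u).nonDiag :=
        card_nonDiag_localComp_lt (by rw [label_localComp_of_adj hadj]; exact hv.isY_mulS)
      obtain ⟨t, ht, h⟩ := ihN _ (hlt.trans_le hsub) _ rfl
      exact ⟨t, ht.head.head, h⟩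
    · push Not at hv
      have hdiag (v) (hadj : s.graph.Adj u v) : (s.label v).IsDiag := by
        by_contra h
        exact hY v (CliffordWord.isY_of_not _ h (hv v hadj))
      -- Only non-increase of the first count is known here; a strict drop goes to the outer
      -- induction.
      rcases hsub.lt_or_eq with hlt | heq
      · obtain ⟨t, ht, h⟩ := ihN _ hlt _ rfl
        exact ⟨t, ht.head, h⟩
      · obtain ⟨t, ht, h⟩ := ihM _ (card_oddX_localComp_lt hu hdiag) _ heq rfl
        exact ⟨t, ht.head, h⟩
  · push Not at hX
    exact ⟨s, ⟨[], rfl⟩, fun v => CliffordWord.isPreReduced_of_not _ (hY v) (hX v)⟩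

/-- Two complementations at a bad vertex repair it, and the `Z` left on neighbours preserves both
the reduced and the pre-reduced forms. -/
theorem exists_reaches_isReduced_of_isPreReduced (s : LabelledGraph V)
    (hs : ∀ v, (s.label v).IsPreReduced) :
    ∃ t, s.Reaches t ∧ ∀ v, (t.label v).IsReduced := by
  induction hN : #s.nonReduced using Nat.strong_induction_on generalizing s with
  | _ N ih =>
  subst hN
  by_cases h : ∃ u, ¬ (s.label u).IsReduced
  · obtain ⟨u, hu⟩ := h
    have hself : (((s.localComp u).localComp u).label u).IsReduced := by
      rw [label_localComp_self, label_localComp_self]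
      exact (hs u).isReduced_mulT_mulT hu
    have hlt : #((s.localComp u).localComp u).nonReduced < #s.nonReduced := by
      refine card_lt_card ((ssubset_iff_of_subset ?_).2 ⟨u, ?_, ?_⟩)
      · intro v hv
        rw [mem_nonReduced] at hv ⊢
        by_cases hvu : v = u
        · exact hvu ▸ hu
        · rcases label_localComp_localComp_of_ne (s := s) hvu with h' | h' <;> rw [h'] at hv
          · exact hv
          · exact fun h => hv h.mulS_mulS
      · rwa [mem_nonReduced]
      · rwa [mem_nonReduced, not_not]
    obtain ⟨t, ht, h⟩ := ih _ hlt _ (fun v => by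
      by_cases hvu : v = u
      · exact hvu ▸ hself.isPreReduced
      · rcases label_localComp_localComp_of_ne (s := s) hvu with h' | h' <;> rw [h']
        · exact hs v
        · exact (hs v).mulS_mulS) rfl
    exact ⟨t, ht.head.head, h⟩
  · push Not at h
    exact ⟨s, ⟨[], rfl⟩, h⟩

end LabelledGraph

/-! ### Existence of reduced forms -/

theorem transpose_mem_localClifford {A : QMat} (hA : A ∈ localClifford) : Aᵀ ∈ localClifford := by
  induction hA using Submonoid.closure_induction with
  | mem A h =>
    rcases h with rfl | rfl
    · rw [hadamard_transpose]
      exact hadamard_mem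
    · rw [phaseS_transpose]
      exact phaseS_mem
  | one => rw [transpose_one]; exact one_mem _
  | mul A B _ _ hA hB => rw [transpose_mul]; exact mul_mem hB hA

namespace GSLC

variable {I O : Type*}

/-- The labelled graph `s` describes the GS-LC form `D` up to scalars. -/
def HasLabels (D : GSLC I O) (s : LabelledGraph (I ⊕ O)) : Prop :=
  D.graph = s.graph ∧ ∀ v, Proportional (D.vertexOp v) (s.label v).gate

theorem exists_hasLabels (D : GSLC I O) : ∃ s, D.HasLabels s := by
  have h (v : I ⊕ O) : ∃ w : CliffordWord, Proportional (D.vertexOp v) w.gate := by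
    refine CliffordWord.exists_gate ?_
    cases v with
    | inl i => exact transpose_mem_localClifford (D.inOp_mem i)
    | inr o => exact D.outOp_mem o
  choose w hw using h
  exact ⟨⟨D.graph, w⟩, rfl, hw⟩

theorem HasLabels.localComp {D : GSLC I O} {s : LabelledGraph (I ⊕ O)} (h : D.HasLabels s)
    (u : I ⊕ O) : (D.localComp u).HasLabels (s.localComp u) := by
  refine ⟨congrArg (localComplement · u) h.1, fun v => ?_⟩
  rw [vertexOp_localComp, h.1, localCompGate, LabelledGraph.localComp]
  have hv := h.2 v
  dsimp only
  split_ifs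
  · exact (hv.mul (.refl _)).trans (CliffordWord.gate_mulT _)
  · exact (hv.mul (.refl _)).trans (CliffordWord.gate_mulS _)
  · rwa [Matrix.mul_one]

theorem HasLabels.localComps {D : GSLC I O} {s : LabelledGraph (I ⊕ O)} (h : D.HasLabels s)
    (us : List (I ⊕ O)) : (D.localComps us).HasLabels (us.foldl LabelledGraph.localComp s) := by
  induction us generalizing D s with
  | nil => exact h
  | cons u us ih => exact ih (h.localComp u)

theorem HasLabels.isReduced {D : GSLC I O} {s : LabelledGraph (I ⊕ O)} (h : D.HasLabels s)
    (hs : ∀ v, (s.label v).IsReduced) : D.IsReduced := by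
  have key (v : I ⊕ O) : (∃ k : ℕ, Proportional (D.vertexOp v) (phaseS ^ k)) ∨
      Proportional (D.vertexOp v) hadamard ∨ Proportional (D.vertexOp v) (hadamard * pauliZ) := by
    have hv := h.2 v
    rcases (hs v).gate with ⟨k, hk⟩ | hk | hk <;> rw [hk] at hv
    exacts [.inl ⟨k, hv⟩, .inr (.inl hv), .inr (.inr hv)]
  refine ⟨fun i => ?_, fun o => key (.inr o)⟩
  have ht : (D.vertexOp (.inl i))ᵀ = D.inOp i := transpose_transpose _
  rcases key (.inl i) with ⟨k, hk⟩ | hk | hk <;> have hk := hk.transpose <;> rw [ht] at hk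
  · rw [transpose_pow, phaseS_transpose] at hk
    exact .inl ⟨k, hk⟩
  · rw [hadamard_transpose] at hk
    exact .inr (.inl hk)
  · rw [transpose_mul, hadamard_transpose, pauliZ_transpose] at hk
    exact .inr (.inr hk)

theorem exists_isReduced_localComps [Fintype I] [Fintype O] (D : GSLC I O) :
    ∃ us : List (I ⊕ O), (D.localComps us).IsReduced := by
  obtain ⟨s, hs⟩ := D.exists_hasLabels
  obtain ⟨t, hst, ht⟩ := s.exists_reaches_isPreReduced
  obtain ⟨r, htr, hr⟩ := t.exists_reaches_isReduced_of_isPreReduced ht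
  obtain ⟨us, rfl⟩ := hst.trans htr
  exact ⟨us, (hs.localComps us).isReduced hr⟩

end GSLC

/-! ### Sign functions on a sum of vertex sets -/

section Bipartition

variable {α β : Type*}

/-- Unordered pairs in a sum are pairs in either summand or mixed pairs. -/
def sym2SumMap : Sym2 α ⊕ Sym2 β ⊕ α × β → Sym2 (α ⊕ β)
  | .inl e => e.map Sum.inl
  | .inr (.inl e) => e.map Sum.inr
  | .inr (.inr (a, b)) => s(.inl a, .inr b)

theorem sym2SumMap_bijective : Function.Bijective (sym2SumMap (α := α) (β := β)) := by
  constructor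
  · rintro (⟨v, w⟩ | ⟨v, w⟩ | ⟨a, b⟩) (⟨v', w'⟩ | ⟨v', w'⟩ | ⟨a', b'⟩) h <;>
      simp [sym2SumMap] at h ⊢ <;> exact h
  · intro e
    induction e with
    | _ v w =>
      rcases v with v | v <;> rcases w with w | w
      exacts [⟨.inl s(v, w), rfl⟩, ⟨.inr (.inr (v, w)), rfl⟩, ⟨.inr (.inr (w, v)), Sym2.eq_swap⟩,
        ⟨.inr (.inl s(v, w)), rfl⟩]

open Classical in
theorem graphSign_sumElim [Fintype α] [Fintype β] (G : SimpleGraph (α ⊕ β)) (x : α → Fin 2)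
    (y : β → Fin 2) : graphSign G (Sum.elim x y) =
      graphSign (G.comap Sum.inl) x * graphSign (G.comap Sum.inr) y *
        ∏ b, ∏ a, if G.Adj (.inl a) (.inr b) ∧ x a = 1 ∧ y b = 1 then (-1 : ℂ) else 1 := by
  rw [graphSign, ← sym2SumMap_bijective.prod_comp, Fintype.prod_sum_type, Fintype.prod_sum_type,
    Fintype.prod_prod_type_right, ← mul_assoc, graphSign, graphSign]
  congr 1
  · congr 1 <;> refine prod_congr rfl fun e _ => ?_ <;> induction e <;> simp [sym2SumMap]
  · simp [sym2SumMap]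

end Bipartition

/-! ### CNOT circuits -/

section Cnot

variable {n : ℕ}

/-- The action of a matrix over `ℤ/2` on basis states. -/
def linearAct (Γ : Matrix (Fin n) (Fin n) (ZMod 2)) (x : Fin n → Fin 2) : Fin n → Fin 2 :=
  Γ.mulVec (α := ZMod 2) x

/-- The map sending the basis state `x` to the basis state `Γ x`. -/
noncomputable def linearGate (Γ : Matrix (Fin n) (Fin n) (ZMod 2)) : NMat n :=
  Matrix.of fun y x => if y = linearAct Γ x then 1 else 0

theorem linearGate_apply (Γ : Matrix (Fin n) (Fin n) (ZMod 2)) (y x : Fin n → Fin 2) :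
    linearGate Γ y x = if y = linearAct Γ x then 1 else 0 := rfl

theorem mul_linearGate_apply (M : NMat n) (Γ : Matrix (Fin n) (Fin n) (ZMod 2))
    (y x : Fin n → Fin 2) : (M * linearGate Γ) y x = M y (linearAct Γ x) := by
  simp [mul_apply, linearGate_apply]

theorem linearAct_mul (Γ Δ : Matrix (Fin n) (Fin n) (ZMod 2)) (x : Fin n → Fin 2) :
    linearAct (Γ * Δ) x = linearAct Γ (linearAct Δ x) :=
  (mulVec_mulVec (α := ZMod 2) x Γ Δ).symm

theorem linearAct_one (x : Fin n → Fin 2) : linearAct 1 x = x := one_mulVec (α := ZMod 2) x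

theorem linearAct_transvection (c t : Fin n) (x : Fin n → Fin 2) :
    linearAct (transvection t c 1) x = Function.update x t (x t + x c) := by
  -- `Fin 2` and `ZMod 2` agree by definition; the computation is stated over `ZMod 2` to use its
  -- ring structure.
  have key (x : Fin n → ZMod 2) :
      transvection t c (1 : ZMod 2) *ᵥ x = Function.update x t (x t + x c) := by
    ext j
    rw [transvection, add_mulVec, one_mulVec, single_mulVec]
    by_cases h : j = t
    · subst h
      simp
    · simp [h]
  exact key x

theorem linearGate_mul (Γ Δ : Matrix (Fin n) (Fin n) (ZMod 2)) :
    linearGate (Γ * Δ) = linearGate Γ * linearGate Δ := by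
  ext y x
  rw [mul_linearGate_apply, linearGate_apply, linearGate_apply, linearAct_mul]

theorem linearGate_one : linearGate (1 : Matrix (Fin n) (Fin n) (ZMod 2)) = 1 := by
  ext y x
  rw [linearGate_apply, linearAct_one, one_apply]

theorem linearGate_transvection (c t : Fin n) :
    linearGate (transvection t c (1 : ZMod 2)) = cnot c t := by
  ext y x
  rw [linearGate_apply, cnot, of_apply, linearAct_transvection]

/-- Gaussian elimination: over `ℤ/2` the only invertible diagonal matrix is the identity, and the
nontrivial transvections are CNOTs. -/
theorem linearGate_mem_cnotCircuits (Γ : Matrix (Fin n) (Fin n) (ZMod 2)) (h : Γ.det ≠ 0) :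
    linearGate Γ ∈ cnotCircuits n := by
  have hone (a : ZMod 2) (ha : a ≠ 0) : a = 1 := by
    revert a
    decide
  refine diagonal_transvection_induction_of_det_ne_zero (fun Γ => linearGate Γ ∈ cnotCircuits n)
    Γ h ?_ ?_ ?_
  · intro D hD
    have : D = 1 := by
      funext j
      rw [det_diagonal, prod_ne_zero_iff] at hD
      exact hone _ (hD j (mem_univ j))
    rw [this, diagonal_one', linearGate_one]
    exact one_mem _
  · rintro ⟨t, c, htc, a⟩
    rw [TransvectionStruct.toMatrix_mk]
    by_cases ha : a = 0
    · rw [ha, transvection_zero, linearGate_one]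
      exact one_mem _
    · rw [hone a ha, linearGate_transvection]
      exact Submonoid.subset_closure ⟨c, t, htc.symm, rfl⟩
  · intro Γ Δ _ _ hΓ hΔ
    rw [linearGate_mul]
    exact mul_mem hΓ hΔ

/-- A nonzero kernel vector `v` would make columns `v` and `0` of the gate equal. -/
theorem det_ne_zero_of_isUnit_linearGate (Γ : Matrix (Fin n) (Fin n) (ZMod 2))
    (h : IsUnit (linearGate Γ)) : Γ.det ≠ 0 := by
  intro hdet
  obtain ⟨v, hv, hΓ⟩ : ∃ v : Fin n → Fin 2, v ≠ 0 ∧ linearAct Γ v = linearAct Γ 0 := by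
    obtain ⟨v, hv, hΓ⟩ := exists_mulVec_eq_zero_iff.2 hdet
    exact ⟨v, hv, hΓ.trans (mulVec_zero Γ).symm⟩
  rw [isUnit_iff_isUnit_det, isUnit_iff_ne_zero] at h
  refine h (det_zero_of_column_eq hv fun y => ?_)
  rw [linearGate_apply, linearGate_apply, hΓ]

theorem hadamard_apply (a b : Fin 2) :
    hadamard a b = ((1 / Real.sqrt 2 : ℝ) : ℂ) * if a = 1 ∧ b = 1 then -1 else 1 := by
  fin_cases a <;> fin_cases b <;> simp [hadamard]

theorem ite_sum_eq_one {ι : Type*} (s : Finset ι) (f : ι → ZMod 2) :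
    (if ∑ i ∈ s, f i = 1 then (-1 : ℂ) else 1) = ∏ i ∈ s, if f i = 1 then -1 else 1 := by
  classical
  induction s using Finset.induction_on with
  | empty => simp
  | insert i s hi ih =>
    rw [sum_insert hi, prod_insert hi, ← ih]
    generalize ∑ i ∈ s, f i = b
    generalize f i = a
    have h (a : ZMod 2) : a = 0 ∨ a = 1 := by
      revert a
      decide
    have h2 : (1 + 1 : ZMod 2) = 0 := rfl
    rcases h a with rfl | rfl <;> rcases h b with rfl | rfl <;> simp [h2]

/-- The entry of the Hadamard layer at `(y, Γx)` is `2^(-n/2) (-1)^(y · Γx)`; expanding the exponent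
gives one sign per nonzero entry of `Γ`. -/
theorem hLayer_univ_mul_linearGate_apply (Γ : Matrix (Fin n) (Fin n) (ZMod 2))
    (y x : Fin n → Fin 2) : (hLayer univ * linearGate Γ : NMat n) y x =
      ((1 / Real.sqrt 2 : ℝ) : ℂ) ^ n *
        ∏ b, ∏ a, if Γ b a = 1 ∧ x a = 1 ∧ y b = 1 then (-1 : ℂ) else 1 := by
  have hmul (a b : ZMod 2) : a * b = 1 ↔ a = 1 ∧ b = 1 := by
    revert a b
    decide
  have hact (b : Fin n) : (if linearAct Γ x b = 1 then (-1 : ℂ) else 1) =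
      ∏ a, if Γ b a = 1 ∧ x a = 1 then (-1 : ℂ) else 1 := by
    have h (x : Fin n → ZMod 2) : (if (Γ *ᵥ x) b = 1 then (-1 : ℂ) else 1) =
        ∏ a, if Γ b a = 1 ∧ x a = 1 then (-1 : ℂ) else 1 := by
      simp only [mulVec, dotProduct, ite_sum_eq_one, hmul]
    exact h x
  rw [mul_linearGate_apply, hLayer, tensor_apply]
  simp only [mem_univ, if_true, hadamard_apply, prod_mul_distrib, prod_const, card_univ,
    Fintype.card_fin]
  congr 1
  refine prod_congr rfl fun b _ => ?_
  by_cases hb : y b = 1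
  · simpa [hb] using hact b
  · simp [hb]

end Cnot

/-! ### The eight layers -/

section Layers

variable {n : ℕ}

theorem exists_layers_of_out {B : Fin n → QMat}
    (h : ∀ o, (∃ k : ℕ, Proportional (B o) (phaseS ^ k)) ∨ Proportional (B o) hadamard ∨
      Proportional (B o) (hadamard * pauliZ)) :
    ∃ (T : Finset (Fin n)) (k : Fin n → ℕ), Proportional (tensor B) (hLayer T * sLayer k) := by
  classical
  have key (o) : ∃ (p : Prop) (k : ℕ),
      Proportional (B o) ((if p then hadamard else 1) * phaseS ^ k) := by
    rcases h o with ⟨k, hk⟩ | hk | hk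
    · exact ⟨False, k, by simpa using hk⟩
    · exact ⟨True, 0, by simpa using hk⟩
    -- The exponent 2 comes from `Z = S^2`.
    · exact ⟨True, 2, by simpa [pauliZ_eq] using hk⟩
  choose p k hk using key
  refine ⟨({o | p o} : Finset (Fin n)), k, ?_⟩
  rw [hLayer, sLayer, tensor_mul]
  exact .tensor fun o => by simpa using hk o

theorem exists_layers_of_in {A : Fin n → QMat}
    (h : ∀ i, (∃ k : ℕ, Proportional (A i) (phaseS ^ k)) ∨ Proportional (A i) hadamard ∨
      Proportional (A i) (pauliZ * hadamard)) :
    ∃ (T : Finset (Fin n)) (k : Fin n → ℕ), Proportional (tensor A) (sLayer k * hLayer T) := by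
  classical
  have key (i) : ∃ (p : Prop) (k : ℕ),
      Proportional (A i) (phaseS ^ k * (if p then hadamard else 1)) := by
    rcases h i with ⟨k, hk⟩ | hk | hk
    · exact ⟨False, k, by simpa using hk⟩
    · exact ⟨True, 0, by simpa using hk⟩
    · exact ⟨True, 2, by simpa [pauliZ_eq] using hk⟩
  choose p k hk using key
  refine ⟨({i | p i} : Finset (Fin n)), k, ?_⟩
  rw [hLayer, sLayer, tensor_mul]
  exact .tensor fun i => by simpa using hk i

open Classical in
/-- The edges between the inputs and the outputs, as a matrix. -/
noncomputable def biadjacency (G : SimpleGraph (Fin n ⊕ Fin n)) : Matrix (Fin n) (Fin n) (ZMod 2) :=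
  Matrix.of fun b a => if G.Adj (.inl a) (.inr b) then 1 else 0

theorem proportional_graphSign (G : SimpleGraph (Fin n ⊕ Fin n)) :
    Proportional (Matrix.of fun y x => graphSign G (Sum.elim x y) : NMat n)
      (czLayer (G.comap Sum.inr) * (hLayer univ * linearGate (biadjacency G)) *
        czLayer (G.comap Sum.inl)) := by
  classical
  refine .symm ⟨((1 / Real.sqrt 2 : ℝ) : ℂ) ^ n, pow_ne_zero _ inv_sqrt_two_ne_zero, ?_⟩
  ext y x
  rw [czLayer, czLayer, mul_diagonal, diagonal_mul, hLayer_univ_mul_linearGate_apply, Matrix.smul_apply,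
    of_apply, graphSign_sumElim, smul_eq_mul]
  have : ∀ a b, biadjacency G b a = 1 ↔ G.Adj (.inl a) (.inr b) := by
    intro a b
    simp [biadjacency]
  simp only [this]
  ring

theorem GSLC.IsReduced.hasEightLayerForm {D : GSLC (Fin n) (Fin n)} (hD : D.IsReduced)
    (h : IsUnit D.toMatrix) : HasEightLayerForm D.toMatrix := by
  obtain ⟨T₁, k₁, h₁⟩ := exists_layers_of_in hD.1
  obtain ⟨T₃, k₂, h₃⟩ := exists_layers_of_out hD.2
  have key : Proportional D.toMatrix _ := (h₃.mul (proportional_graphSign D.graph)).mul h₁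
  obtain ⟨c, hc, hM⟩ := id key
  have hdet : (biadjacency D.graph).det ≠ 0 := by
    refine det_ne_zero_of_isUnit_linearGate _ ?_
    -- All factors are square, so a nonzero determinant of the product forces each factor, in
    -- particular the linear gate, to be invertible.
    rw [isUnit_iff_isUnit_det, hM, det_smul] at h
    simp only [det_mul, isUnit_iff_ne_zero, mul_ne_zero_iff] at h
    rw [isUnit_iff_isUnit_det, isUnit_iff_ne_zero]
    tauto
  refine ⟨T₁, univ, T₃, k₁, k₂, D.graph.comap Sum.inl, D.graph.comap Sum.inr, _,
    linearGate_mem_cnotCircuits _ hdet, ?_⟩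
  simpa only [Matrix.mul_assoc] using key

end Layers

end ZXClifford

theorem mainTheorem10 :
    (∀ (m n : ℕ) (D : ZXClifford.GSLC (Fin m) (Fin n)),
      (∃ us : List (Fin m ⊕ Fin n), (D.localComps us).IsReduced) ∧
      ∀ us : List (Fin m ⊕ Fin n),
        ZXClifford.Proportional (D.localComps us).toMatrix D.toMatrix) ∧
    (∀ (n : ℕ) (D : ZXClifford.GSLC (Fin n) (Fin n)), IsUnit D.toMatrix →
      ∀ us : List (Fin n ⊕ Fin n), (D.localComps us).IsReduced →
        ZXClifford.HasEightLayerForm (D.localComps us).toMatrix) := by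
  refine ⟨fun m n D => ⟨D.exists_isReduced_localComps, fun us => .of_eq (D.toMatrix_localComps us)⟩,
    fun n D hD us hus => hus.hasEightLayerForm ?_⟩
  rwa [D.toMatrix_localComps us]
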